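/- Let $(W_t)_{t\ge 0}$ be a standard one-dimensional Brownian motion (started at $0$), let $a,b,x_0$ be real numbers with $a<x_0<b$, and let $$\tau=\inf\{t\ge 0 : x_0+W_t\notin\,]a,b[\,\}$$ (with $\inf\emptyset=\infty$) be the exit time of $x_0+W$ from $]a,b[$. Put $f(z)=\sum_{n=0}^\infty(-1)^n\frac{z^n}{(2n)!}$ for $z\in\mathbb C$ and $$g(\gamma)=\frac{f\left(\frac{(b+a-2x_0)^2}{2}\gamma\right)}{f\left(\frac{(b-a)^2}{2}\gamma\right)}.$$ Then $\tau$ is a random variable (measurable up to a null set), and for every real $\gamma\ge 0$: (i) if $\gamma<\frac{\pi^2}{2(b-a)^2}$, then $$E\left(e^{\gamma\tau}\right)=g(\gamma)=\frac{\cos\left((b+a-2x_0)\sqrt{\gamma/2}\right)}{\cos\left((b-a)\sqrt{\gamma/2}\right)};$$ (ii) if $\gamma\ge\frac{\pi^2}{2(b-a)^2}$, then $E\left(e^{\gamma\tau}\right)=\infty$. -/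

import Mathlib

open MeasureTheory ProbabilityTheory
open scoped NNReal ENNReal

/-- The first exit time of the real process `X` from the set `D`, i.e. the infimum of the times
`t ≥ 0` with `X t ∉ D`, which is `∞` if the process never leaves `D`. -/
noncomputable def exitTime {Ω : Type*} (X : ℝ≥0 → Ω → ℝ) (D : Set ℝ) : Ω → ℝ≥0∞ :=
  fun ω ↦ hittingAfter X Dᶜ 0 ω

/-- `E(e^{γ T})` as an element of `[0, ∞]`, for a random time `T` with values in `[0, ∞]`
(for `γ > 0`, the integrand is `∞` where `T = ∞`; for `γ = 0` it is `1`). -/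
noncomputable def expMoment {Ω : Type*} [MeasurableSpace Ω] (P : Measure Ω) (T : Ω → ℝ≥0∞)
    (γ : ℝ) : ℝ≥0∞ :=
  ∫⁻ ω, EReal.exp ((γ : EReal) * (T ω : EReal)) ∂P

/-- The entire function `f(z) = ∑ (-1)^n z^n / (2n)!`. -/
noncomputable def cosSqrt (z : ℂ) : ℂ :=
  ∑' n : ℕ, (-1) ^ n * z ^ n / ((2 * n).factorial : ℂ)

/-- The meromorphic function
`g(γ) = f((b + a - 2 x₀)² γ / 2) / f((b - a)² γ / 2)`. -/
noncomputable def exitMGF (a b x₀ : ℝ) (γ : ℂ) : ℂ :=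
  cosSqrt (((b + a - 2 * x₀ : ℝ) : ℂ) ^ 2 / 2 * γ) / cosSqrt (((b - a : ℝ) : ℂ) ^ 2 / 2 * γ)

/-! Centre the interval with `c = x₀ - (a + b) / 2` and put `γ = θ² / 2`. The process `e^{θ² t / 2}
cos (θ (B t + c))` is a martingale (`setIntegral_expCos_eq`), and at the exit time `|B + c| = (b -
a) / 2`, so its cosine factor is then the constant `κ = cos (θ (b - a) / 2)`. Formally, optional
stopping gives `cos (θ c) = κ E(e^{γτ})`.

For `θ (b - a) / 2 < π / 2` the cosine is at least `κ > 0` up to time `τ`. Fatou's lemma then makes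
`E(e^{γτ})` finite, after which `e^{γτ}` itself dominates the stopped martingale and the identity is
exact (`expMoment_exitTime_eq`). As `θ` increases to `π / (b - a)`, `κ` tends to `0` while the
numerator stays positive, so monotonicity in `γ` forces `∞` from the critical value on. -/

theorem cosSqrt_sq (z : ℂ) : cosSqrt (z ^ 2) = Complex.cos z := by
  rw [cosSqrt, Complex.cos_eq_tsum]
  congr with n
  rw [pow_mul]

theorem exitMGF_ofReal (a b x₀ : ℝ) {γ : ℝ} (hγ : 0 ≤ γ) :
    exitMGF a b x₀ γ = ((Real.cos ((b + a - 2 * x₀) * √(γ / 2)) /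
      Real.cos ((b - a) * √(γ / 2)) : ℝ) : ℂ) := by
  have key (y : ℝ) : cosSqrt ((y : ℂ) ^ 2 / 2 * γ) = (Real.cos (y * √(γ / 2)) : ℝ) := by
    rw [Complex.ofReal_cos, ← cosSqrt_sq]
    congr 1
    rw [← Complex.ofReal_pow (y * _), mul_pow, Real.sq_sqrt (by positivity)]
    push_cast
    ring
  rw [exitMGF, key, key, Complex.ofReal_div]

/-! ### Regular version of the process and Gaussian trigonometric moments -/

/-- Set the process to `0` on a measurable null set outside which paths are continuous, start at `0`
and agree with measurable versions at a dense sequence of times. Continuity carries measurability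
from those times to all others. -/
theorem ProbabilityTheory.IsBrownianReal.exists_continuous_modification {Ω : Type*}
    [MeasurableSpace Ω] {P : Measure Ω} {W : ℝ≥0 → Ω → ℝ} (hW : IsBrownianReal W P) :
    ∃ B : ℝ≥0 → Ω → ℝ, IsPreBrownianReal B P ∧ (∀ t, Measurable (B t)) ∧
      (∀ ω, Continuous (B · ω)) ∧ (∀ ω, B 0 ω = 0) ∧ ∀ᵐ ω ∂P, ∀ t, W t ω = B t ω := by
  classical
  let q : ℕ → ℝ≥0 := TopologicalSpace.denseSeq ℝ≥0
  have hae : ∀ᵐ ω ∂P, Continuous (W · ω) ∧ W 0 ω = 0 ∧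
      ∀ n, W (q n) ω = (hW.aemeasurable (q n)).mk _ ω := by
    filter_upwards [hW.cont, hW.eval_zero_ae_eq_zero,
      ae_all_iff.2 fun n ↦ (hW.aemeasurable (q n)).ae_eq_mk] with ω h₁ h₂ h₃
    exact ⟨h₁, h₂, h₃⟩
  obtain ⟨N, hN, hNm, hN0⟩ := exists_measurable_superset_of_null (ae_iff.1 hae)
  have hG : ∀ ω ∈ Nᶜ, Continuous (W · ω) ∧ W 0 ω = 0 ∧
      ∀ n, W (q n) ω = (hW.aemeasurable (q n)).mk _ ω := by
    intro ω hω
    by_contra h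
    exact hω (hN h)
  have hWB : ∀ᵐ ω ∂P, ∀ t, W t ω = Nᶜ.indicator (W t) ω := by
    filter_upwards [compl_mem_ae_iff.2 hN0] with ω hω t
    rw [Set.indicator_of_mem hω]
  have hcont : ∀ ω, Continuous fun t ↦ Nᶜ.indicator (W t) ω := by
    intro ω
    by_cases hω : ω ∈ Nᶜ
    · simpa only [Set.indicator_of_mem hω] using (hG ω hω).1
    · simpa only [Set.indicator_of_notMem hω] using continuous_const
  refine ⟨fun t ↦ Nᶜ.indicator (W t), ?_, fun t ↦ ?_, hcont, fun ω ↦ ?_, hWB⟩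
  · exact hW.toIsPreBrownianReal.congr fun t ↦ hWB.mono fun ω h ↦ h t
  · obtain ⟨u, hu, hut⟩ := mem_closure_iff_seq_limit.1
      ((TopologicalSpace.denseRange_denseSeq ℝ≥0).closure_range ▸ Set.mem_univ t)
    choose k hk using hu
    refine measurable_of_tendsto_metrizable (f := fun n ↦ Nᶜ.indicator (W (u n))) (fun n ↦ ?_)
      (tendsto_pi_nhds.2 fun ω ↦ ((hcont ω).tendsto t).comp hut)
    have : Nᶜ.indicator (W (u n)) = Nᶜ.indicator ((hW.aemeasurable (q (k n))).mk _) := by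
      refine Set.indicator_congr fun ω hω ↦ ?_
      rw [← (hG ω hω).2.2 (k n), ← hk n]
    rw [this]
    exact (hW.aemeasurable _).measurable_mk.indicator hNm.compl
  · by_cases hω : ω ∈ Nᶜ
    · simpa only [Set.indicator_of_mem hω] using (hG ω hω).2.1
    · simp only [Set.indicator_of_notMem hω]

theorem ProbabilityTheory.HasLaw.integral_cos_mul_gaussianReal {Ω : Type*} [MeasurableSpace Ω]
    {P : Measure Ω} {Z : Ω → ℝ} {v : ℝ≥0} (hZ : HasLaw Z (gaussianReal 0 v) P) (θ : ℝ) :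
    ∫ ω, Real.cos (θ * Z ω) ∂P = Real.exp (-(θ ^ 2 / 2 * v)) ∧
      ∫ ω, Real.sin (θ * Z ω) ∂P = 0 := by
  have hcf := charFun_gaussianReal (μ := 0) (v := v) θ
  rw [charFun_apply_real] at hcf
  have hint : Integrable (fun x : ℝ ↦ Complex.exp (θ * x * Complex.I)) (gaussianReal 0 v) := by
    refine Integrable.of_bound (by fun_prop) 1 (.of_forall fun x ↦ ?_)
    rw [← Complex.ofReal_mul, Complex.norm_exp_ofReal_mul_I]
  have hval : Complex.exp (θ * (0 : ℝ) * Complex.I - v * θ ^ 2 / 2)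
      = (Real.exp (-(θ ^ 2 / 2 * v)) : ℝ) := by
    push_cast
    congr 1
    ring
  rw [hval] at hcf
  constructor
  · have h := congrArg Complex.re hcf
    rw [Complex.ofReal_re] at h
    rw [← h]
    refine (hZ.integral_comp (f := fun x ↦ Real.cos (θ * x)) (by fun_prop)).trans ?_
    refine Eq.trans ?_ (integral_re hint)
    congr with x
    rw [← Complex.ofReal_mul]
    exact (Complex.exp_ofReal_mul_I_re _).symm
  · have h := congrArg Complex.im hcf
    rw [Complex.ofReal_im] at h
    rw [← h]
    refine (hZ.integral_comp (f := fun x ↦ Real.sin (θ * x)) (by fun_prop)).trans ?_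
    refine Eq.trans ?_ (integral_im hint)
    congr with x
    rw [← Complex.ofReal_mul]
    exact (Complex.exp_ofReal_mul_I_im _).symm

/-! ### The cosine martingale and optional stopping at bounded times -/

section Martingale

variable {Ω : Type*}

/-- The `σ`-algebra generated by the process `B` up to time `t`. -/
abbrev pastSigma (B : ℝ≥0 → Ω → ℝ) (t : ℝ≥0) : MeasurableSpace Ω :=
  MeasurableSpace.comap (fun ω (s : Set.Iic t) ↦ B s ω) MeasurableSpace.pi

/-- The process `e^{θ² t / 2} cos (θ (B t + c))`. -/
noncomputable def expCos (B : ℝ≥0 → Ω → ℝ) (θ c : ℝ) (t : ℝ≥0) (ω : Ω) : ℝ :=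
  Real.exp (θ ^ 2 / 2 * t) * Real.cos (θ * (B t ω + c))

variable {B : ℝ≥0 → Ω → ℝ}

theorem pastSigma_mono {s t : ℝ≥0} (hst : s ≤ t) : pastSigma B s ≤ pastSigma B t := by
  rintro _ ⟨A, hA, rfl⟩
  refine ⟨(fun (x : Set.Iic t → ℝ) (r : Set.Iic s) ↦ x ⟨r, r.2.trans hst⟩) ⁻¹' A, ?_, rfl⟩
  exact (measurable_pi_lambda _ fun r ↦ measurable_pi_apply _) hA

theorem abs_expCos_le (θ c : ℝ) {t u : ℝ≥0} (htu : t ≤ u) (ω : Ω) :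
    |expCos B θ c t ω| ≤ Real.exp (θ ^ 2 / 2 * u) := by
  rw [expCos, abs_mul, Real.abs_exp]
  calc _ ≤ Real.exp (θ ^ 2 / 2 * t) * 1 := by gcongr; exact Real.abs_cos_le_one _
    _ ≤ _ := by rw [mul_one]; gcongr

variable [MeasurableSpace Ω] {P : Measure Ω}

theorem pastSigma_le (hm : ∀ t, Measurable (B t)) (t : ℝ≥0) :
    pastSigma B t ≤ ‹MeasurableSpace Ω› :=
  (measurable_pi_lambda _ fun s : Set.Iic t ↦ hm s).comap_le

theorem measurable_expCos (hm : ∀ t, Measurable (B t)) (θ c : ℝ) (t : ℝ≥0) :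
    Measurable (expCos B θ c t) := by
  have := hm t
  unfold expCos
  fun_prop

theorem integrable_expCos [IsProbabilityMeasure P] (hm : ∀ t, Measurable (B t)) (θ c : ℝ)
    (t : ℝ≥0) : Integrable (expCos B θ c t) P :=
  Integrable.of_bound (measurable_expCos hm θ c t).aestronglyMeasurable _
    (.of_forall fun ω ↦ abs_expCos_le θ c le_rfl ω)

/-- The martingale property. Expand the cosine by the addition formula: the increment is independent
of the past, its sine has mean `0`, and its cosine has mean `e^{-θ² v / 2}`, which cancels the
growth of the exponential factor. -/
theorem setIntegral_expCos_eq [IsProbabilityMeasure P] (hB : IsPreBrownianReal B P)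
    (hm : ∀ t, Measurable (B t)) (θ c : ℝ) {s t : ℝ≥0} (hst : s ≤ t) {A : Set Ω}
    (hA : MeasurableSet[pastSigma B s] A) :
    ∫ ω in A, expCos B θ c t ω ∂P = ∫ ω in A, expCos B θ c s ω ∂P := by
  have hAm : MeasurableSet A := pastSigma_le hm s _ hA
  obtain ⟨S, hS, rfl⟩ := hA
  obtain ⟨v, rfl⟩ := exists_add_of_le hst
  set R : Ω → Set.Iic s → ℝ := fun ω r ↦ B r ω
  set Z : Ω → ℝ := fun ω ↦ B (s + v) ω - B s ω with hZ
  have hZlaw : HasLaw Z (gaussianReal 0 v) P := (hB.shift s).hasLaw_eval v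
  have hind : IndepFun Z R P :=
    IndepFun.comp (φ := fun x : ℝ≥0 → ℝ ↦ x v) (ψ := id) (hB.indepFun_shift s)
      (measurable_pi_apply v) measurable_id
  have hRm : Measurable R := measurable_pi_lambda _ fun r ↦ hm r
  have hZm : Measurable Z := (hm _).sub (hm _)
  let x₀ : Set.Iic s := ⟨s, Set.mem_Iic.2 le_rfl⟩
  have hRx₀ (ω) : R ω x₀ = B s ω := rfl
  -- The indicator of the event is absorbed into functions of the past, so that independence applies
  -- to full expectations.
  let C : (Set.Iic s → ℝ) → ℝ := S.indicator fun x ↦ Real.cos (θ * (x x₀ + c))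
  let D : (Set.Iic s → ℝ) → ℝ := S.indicator fun x ↦ Real.sin (θ * (x x₀ + c))
  have hC : Measurable C := Measurable.indicator (by fun_prop) hS
  have hD : Measurable D := Measurable.indicator (by fun_prop) hS
  have hcos := (hind.comp (φ := fun z ↦ Real.cos (θ * z))
    (by fun_prop) hC).integral_fun_mul_eq_mul_integral
    (by fun_prop) (hC.comp hRm).aestronglyMeasurable
  have hsin := (hind.comp (φ := fun z ↦ Real.sin (θ * z))
    (by fun_prop) hD).integral_fun_mul_eq_mul_integral
    (by fun_prop) (hD.comp hRm).aestronglyMeasurable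
  obtain ⟨h₁, h₂⟩ := hZlaw.integral_cos_mul_gaussianReal θ
  simp only [Function.comp_apply, h₁, h₂, zero_mul] at hcos hsin
  have hbd (F : Ω → ℝ) (hF : Measurable F) (hF1 : ∀ ω, |F ω| ≤ 1) : Integrable F P :=
    Integrable.of_bound hF.aestronglyMeasurable 1 (.of_forall hF1)
  have hCle (x) : |C x| ≤ 1 := by
    by_cases hx : x ∈ S <;> simp [C, hx, Real.abs_cos_le_one]
  have hDle (x) : |D x| ≤ 1 := by
    by_cases hx : x ∈ S <;> simp [D, hx, Real.abs_sin_le_one]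
  have hsplit : (R ⁻¹' S).indicator (expCos B θ c (s + v)) = fun ω ↦
      Real.exp (θ ^ 2 / 2 * (s + v)) *
        (Real.cos (θ * Z ω) * C (R ω) - Real.sin (θ * Z ω) * D (R ω)) := by
    ext ω
    by_cases hω : R ω ∈ S
    · have : θ * (B (s + v) ω + c) = θ * Z ω + θ * (B s ω + c) := by simp only [hZ]; ring
      simp [C, D, hω, expCos, this, Real.cos_add, hRx₀]
    · simp [C, D, hω]
  have hsplit' : (R ⁻¹' S).indicator (expCos B θ c s) = fun ω ↦
      Real.exp (θ ^ 2 / 2 * s) * C (R ω) := by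
    ext ω
    by_cases hω : R ω ∈ S <;> simp [C, hω, expCos, hRx₀]
  rw [← integral_indicator hAm, ← integral_indicator hAm, hsplit, hsplit', integral_const_mul,
    integral_sub, hcos, hsin, integral_const_mul, sub_zero, ← mul_assoc, ← Real.exp_add]
  · congr 2
    ring
  · refine hbd _ (by fun_prop) fun ω ↦ ?_
    rw [abs_mul]
    exact mul_le_one₀ (Real.abs_cos_le_one _) (abs_nonneg _) (hCle _)
  · refine hbd _ (by fun_prop) fun ω ↦ ?_
    rw [abs_mul]
    exact mul_le_one₀ (Real.abs_sin_le_one _) (abs_nonneg _) (hDle _)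

/-- Rounded up to the grid `δ ℕ`, the stopping time takes finitely many values, and `{K = k}` lies
in the past of `k δ`. On each such event the martingale property moves the value to the common
horizon `N δ`. -/
theorem integral_expCos_natCeil [IsProbabilityMeasure P] (hB : IsPreBrownianReal B P)
    (hm : ∀ t, Measurable (B t)) (θ c : ℝ) {ρ : Ω → ℝ≥0} {T : ℝ≥0} (hρT : ∀ ω, ρ ω ≤ T)
    (hρ : ∀ t, MeasurableSet[pastSigma B t] {ω | ρ ω ≤ t}) {δ : ℝ≥0} (hδ : 0 < δ) :
    Measurable (fun ω ↦ expCos B θ c (⌈ρ ω / δ⌉₊ * δ) ω) ∧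
      ∫ ω, expCos B θ c (⌈ρ ω / δ⌉₊ * δ) ω ∂P = ∫ ω, expCos B θ c 0 ω ∂P := by
  set N : ℕ := ⌈T / δ⌉₊
  set K : Ω → ℕ := fun ω ↦ ⌈ρ ω / δ⌉₊
  have hKN (ω) : K ω ≤ N := Nat.ceil_mono (by gcongr; exact hρT ω)
  have hKle (k : ℕ) : {ω | K ω ≤ k} = {ω | ρ ω ≤ k * δ} := by
    ext ω
    simp only [K, Set.mem_ofPred_eq, Nat.ceil_le, div_le_iff₀ hδ]
  have hKm (k : ℕ) : MeasurableSet[pastSigma B (k * δ)] {ω | K ω = k} := by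
    have hle (j : ℕ) (hj : j ≤ k) : MeasurableSet[pastSigma B (k * δ)] {ω | K ω ≤ j} := by
      rw [hKle]
      exact pastSigma_mono (by gcongr) _ (hρ _)
    cases k with
    | zero =>
      convert! hle 0 le_rfl using 2
      ext ω
      simp
    | succ j =>
      convert! (hle (j + 1) le_rfl).diff (hle j j.le_succ) using 1
      ext ω
      simp only [Set.mem_ofPred_eq, Set.mem_sdiff]
      omega
  have hKm' (k : ℕ) : MeasurableSet {ω | K ω = k} := pastSigma_le hm _ _ (hKm k)
  have hsum (f : ℕ → Ω → ℝ) : (fun ω ↦ f (K ω) ω) =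
      fun ω ↦ ∑ k ∈ Finset.range (N + 1), {ω | K ω = k}.indicator (f k) ω := by
    ext ω
    rw [Finset.sum_eq_single (K ω)]
    · simp
    · intro k _ hk
      exact Set.indicator_of_notMem (fun h ↦ hk h.symm) _
    · intro h
      exact absurd (Finset.mem_range.2 (Nat.lt_succ_of_le (hKN ω))) h
  have hKK := hsum fun k ↦ expCos B θ c (k * δ)
  constructor
  · rw [hKK]
    exact Finset.measurable_sum _ fun k _ ↦ (measurable_expCos hm θ c _).indicator (hKm' k)
  · have h0 : ∫ ω, expCos B θ c 0 ω ∂P = ∫ ω, expCos B θ c (N * δ) ω ∂P := by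
      have := setIntegral_expCos_eq hB hm θ c (zero_le (a := N * δ)) MeasurableSet.univ
      simpa using this.symm
    rw [h0, hKK, hsum fun _ ↦ expCos B θ c (N * δ), integral_finsetSum, integral_finsetSum]
    · refine Finset.sum_congr rfl fun k hk ↦ ?_
      rw [integral_indicator (hKm' k), integral_indicator (hKm' k)]
      refine (setIntegral_expCos_eq hB hm θ c ?_ (hKm k)).symm
      have : k ≤ N := Nat.lt_succ_iff.1 (Finset.mem_range.1 hk)
      gcongr
    · exact fun k _ ↦ (integrable_expCos hm θ c _).indicator (hKm' k)
    · exact fun k _ ↦ (integrable_expCos hm θ c _).indicator (hKm' k)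

/-- Refine the grid: the rounded times decrease to within `δ n → 0` of `ρ`, and path continuity with
dominated convergence passes to the limit. -/
theorem integral_expCos_stopped [IsProbabilityMeasure P] (hB : IsPreBrownianReal B P)
    (hm : ∀ t, Measurable (B t)) (hc : ∀ ω, Continuous (B · ω)) (h0 : ∀ ω, B 0 ω = 0)
    (θ c : ℝ) {ρ : Ω → ℝ≥0} {T : ℝ≥0} (hρT : ∀ ω, ρ ω ≤ T)
    (hρ : ∀ t, MeasurableSet[pastSigma B t] {ω | ρ ω ≤ t}) :
    Measurable (fun ω ↦ expCos B θ c (ρ ω) ω) ∧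
      ∫ ω, expCos B θ c (ρ ω) ω ∂P = Real.cos (θ * c) := by
  let δ : ℕ → ℝ≥0 := fun n ↦ 1 / ((n : ℝ≥0) + 1)
  have hδ (n) : 0 < δ n := by positivity
  have hδ1 (n) : δ n ≤ 1 := by
    simp only [δ]
    exact div_le_one_of_le₀ (by simp) (by positivity)
  have hδ0 : Filter.Tendsto δ .atTop (nhds 0) := tendsto_one_div_add_atTop_nhds_zero_nat
  have hle (n ω) : ρ ω ≤ ⌈ρ ω / δ n⌉₊ * δ n := (div_le_iff₀ (hδ n)).1 (Nat.le_ceil _)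
  have hge (n ω) : ⌈ρ ω / δ n⌉₊ * δ n ≤ ρ ω + δ n := by
    calc _ ≤ (ρ ω / δ n + 1) * δ n := by gcongr; exact (Nat.ceil_lt_add_one zero_le).le
      _ = _ := by rw [add_mul, div_mul_cancel₀ _ (hδ n).ne', one_mul]
  have hlim (ω) : Filter.Tendsto (fun n ↦ (⌈ρ ω / δ n⌉₊ * δ n : ℝ≥0)) .atTop (nhds (ρ ω)) := by
    refine tendsto_of_tendsto_of_tendsto_of_le_of_le tendsto_const_nhds ?_ (hle · ω) (hge · ω)
    simpa using (tendsto_const_nhds (x := ρ ω)).add hδ0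
  have hlim' (ω) : Filter.Tendsto (fun n ↦ expCos B θ c (⌈ρ ω / δ n⌉₊ * δ n) ω) .atTop
      (nhds (expCos B θ c (ρ ω) ω)) := by
    have hcont : Continuous fun t ↦ expCos B θ c t ω := by
      have := hc ω
      unfold expCos
      fun_prop
    exact (hcont.tendsto _).comp (hlim ω)
  have hn n := integral_expCos_natCeil hB hm θ c hρT hρ (hδ n)
  refine ⟨measurable_of_tendsto_metrizable (fun n ↦ (hn n).1) (tendsto_pi_nhds.2 hlim'), ?_⟩
  -- Rounding up overshoots `T` by at most `δ n ≤ 1`, hence the horizon `T + 1`.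
  have hdct := tendsto_integral_of_dominated_convergence (μ := P)
    (fun _ ↦ Real.exp (θ ^ 2 / 2 * (T + 1 : ℝ≥0)))
    (fun n ↦ (hn n).1.aestronglyMeasurable) (integrable_const _)
    (fun n ↦ .of_forall fun ω ↦
      abs_expCos_le θ c ((hge n ω).trans (add_le_add (hρT ω) (hδ1 n))) ω) (.of_forall hlim')
  simp only [(hn _).2] at hdct
  rw [← tendsto_nhds_unique tendsto_const_nhds hdct]
  simp [expCos, h0]

end Martingale

/-! ### Pathwise properties and measurability of exit times -/

section ExitTime

variable {Ω : Type*} {X : ℝ≥0 → Ω → ℝ} {D : Set ℝ} {ω : Ω}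

theorem exitTime_congr {Y : ℝ≥0 → Ω → ℝ} (D : Set ℝ) (h : (X · ω) = (Y · ω)) :
    exitTime X D ω = exitTime Y D ω :=
  -- The exit time depends on one path only, so that path is viewed as a process on a one-point
  -- space.
  congrArg (fun x : ℝ≥0 → ℝ ↦ exitTime (fun t (_ : Unit) ↦ x t) D ()) h

theorem exitTime_le_iff (hD : IsOpen D) (hX : Continuous (X · ω)) (t : ℝ≥0) :
    exitTime X D ω ≤ t ↔ ∃ s ≤ t, X s ω ∉ D := by
  constructor
  · intro h
    have hex : ∃ j : ℝ≥0, 0 ≤ j ∧ X j ω ∈ Dᶜ := by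
      by_contra hne
      have htop : exitTime X D ω = ⊤ := if_neg hne
      rw [htop, top_le_iff] at h
      exact ENNReal.coe_ne_top h
    have hval : exitTime X D ω = (sInf {i : ℝ≥0 | 0 ≤ i ∧ X i ω ∈ Dᶜ} : ℝ≥0) := if_pos hex
    have hmem : sInf {i : ℝ≥0 | 0 ≤ i ∧ X i ω ∈ Dᶜ} ∈ {i : ℝ≥0 | 0 ≤ i ∧ X i ω ∈ Dᶜ} :=
      IsClosed.csInf_mem (isClosed_Ici.inter (hD.isClosed_compl.preimage hX)) hex
        (OrderBot.bddBelow _)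
    rw [hval, ENNReal.coe_le_coe] at h
    exact ⟨_, h, hmem.2⟩
  · rintro ⟨s, hst, hs⟩
    have h : exitTime X D ω ≤ s := hittingAfter_le_of_mem zero_le hs
    exact h.trans (ENNReal.coe_le_coe.2 hst)

theorem mem_of_lt_exitTime {t : ℝ≥0} (ht : t < exitTime X D ω) : X t ω ∈ D :=
  not_not.1 (notMem_of_lt_hittingAfter (s := Dᶜ) ht zero_le)

theorem notMem_of_exitTime_eq (hD : IsOpen D) (hX : Continuous (X · ω)) {t : ℝ≥0}
    (ht : exitTime X D ω = t) : X t ω ∉ D := by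
  obtain ⟨s, hst, hs⟩ := (exitTime_le_iff hD hX t).1 ht.le
  rcases hst.eq_or_lt with rfl | hlt
  · exact hs
  · exact absurd (mem_of_lt_exitTime (ht ▸ ENNReal.coe_lt_coe.2 hlt)) hs

theorem mem_closure_of_le_exitTime (hX : Continuous (X · ω)) (h0 : X 0 ω ∈ D)
    {t : ℝ≥0} (ht : t ≤ exitTime X D ω) : X t ω ∈ closure D := by
  -- At `t = 0` there are no earlier times to approximate from.
  rcases eq_or_ne t 0 with rfl | hne
  · exact subset_closure h0
  refine map_mem_closure (s := Set.Iio t) hX ?_ fun s hs ↦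
    mem_of_lt_exitTime ((ENNReal.coe_lt_coe.2 hs).trans_le ht)
  rw [closure_Iio' ⟨0, pos_iff_ne_zero.2 hne⟩]
  exact Set.self_mem_Iic

/-- No exit has occurred by time `t` exactly when the path stays in `D` on `[0, t]`. By compactness
this means its distance to `Dᶜ` is at least some `1 / n` there, which continuity reduces to
countably many times. -/
theorem measurableSet_exitTime_le {B : ℝ≥0 → Ω → ℝ} (hB : ∀ ω, Continuous (B · ω)) (x₀ : ℝ)
    (hD : IsOpen D) (t : ℝ≥0) :
    MeasurableSet[pastSigma B t] {ω | exitTime (fun t ω ↦ x₀ + B t ω) D ω ≤ t} := by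
  let q : ℕ → Set.Iic t := TopologicalSpace.denseSeq (Set.Iic t)
  let S : Set (Set.Iic t → ℝ) :=
    ⋃ n : ℕ, ⋂ k, {x | (n : ℝ≥0∞)⁻¹ ≤ Metric.infEDist (x₀ + x (q k)) Dᶜ}
  have hpos (x : ℝ) : 0 < Metric.infEDist x Dᶜ ↔ x ∈ D := by
    rw [pos_iff_ne_zero, Ne, ← Metric.mem_closure_iff_infEDist_zero,
      hD.isClosed_compl.closure_eq, Set.mem_compl_iff, not_not]
  have hS : MeasurableSet S := by
    refine .iUnion fun n ↦ .iInter fun k ↦ measurableSet_le measurable_const ?_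
    exact Metric.continuous_infEDist.measurable.comp (by fun_prop)
  refine ⟨Sᶜ, hS.compl, ?_⟩
  ext ω
  have hc := hB ω
  rw [Set.mem_preimage, Set.mem_compl_iff, Set.mem_ofPred_eq, ← not_lt, not_iff_not, ← not_le,
    exitTime_le_iff (X := fun t ω ↦ x₀ + B t ω) hD (by fun_prop)]
  push Not
  have hcont : Continuous fun s : Set.Iic t ↦ Metric.infEDist (x₀ + B s ω) Dᶜ :=
    Metric.continuous_infEDist.comp (by fun_prop)
  simp only [S, Set.mem_iUnion, Set.mem_iInter, Set.mem_ofPred_eq]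
  constructor
  · rintro ⟨n, hn⟩ s hs
    rw [← hpos]
    have hall : ∀ r : Set.Iic t, (n : ℝ≥0∞)⁻¹ ≤ Metric.infEDist (x₀ + B r ω) Dᶜ := by
      intro r
      refine (TopologicalSpace.denseRange_denseSeq (Set.Iic t)).induction_on r
        (isClosed_le continuous_const hcont) hn
    exact (ENNReal.inv_pos.2 (ENNReal.natCast_ne_top n)).trans_le (hall ⟨s, hs⟩)
  · intro h
    have : CompactSpace (Set.Iic t) := by
      rw [← Set.Icc_bot]
      infer_instance
    obtain ⟨r, -, hr⟩ := isCompact_univ.exists_isMinOn Set.univ_nonempty hcont.continuousOn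
    obtain ⟨n, hn⟩ := ENNReal.exists_inv_nat_lt ((hpos _).2 (h r r.2)).ne'
    exact ⟨n, fun k ↦ hn.le.trans (hr (Set.mem_univ _))⟩

end ExitTime

/-! ### Stopping at the truncated exit time -/

section Stopped

variable {Ω : Type*} [MeasurableSpace Ω] {P : Measure Ω} {B : ℝ≥0 → Ω → ℝ}

theorem integral_expCos_min_exitTime [IsProbabilityMeasure P] (hB : IsPreBrownianReal B P)
    (hm : ∀ t, Measurable (B t)) (hc : ∀ ω, Continuous (B · ω)) (h0 : ∀ ω, B 0 ω = 0)
    (x₀ : ℝ) {D : Set ℝ} (hD : IsOpen D) (θ c : ℝ) (T : ℝ≥0) :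
    Measurable (fun ω ↦ expCos B θ c
        (min (exitTime (fun t ω ↦ x₀ + B t ω) D ω) T).toNNReal ω) ∧
      ∫ ω, expCos B θ c (min (exitTime (fun t ω ↦ x₀ + B t ω) D ω) T).toNNReal ω ∂P
        = Real.cos (θ * c) := by
  have hle (ω) (t : ℝ≥0) : (min (exitTime (fun t ω ↦ x₀ + B t ω) D ω) T).toNNReal ≤ t ↔
      exitTime (fun t ω ↦ x₀ + B t ω) D ω ≤ t ∨ T ≤ t := by
    rw [← ENNReal.coe_le_coe, ENNReal.coe_toNNReal (by simp), min_le_iff, ENNReal.coe_le_coe]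
  refine integral_expCos_stopped hB hm hc h0 θ c (T := T) (fun ω ↦ (hle ω T).2 (.inr le_rfl))
    fun t ↦ ?_
  simp only [hle]
  by_cases hT : T ≤ t
  · simp [hT]
  · simpa only [hT, or_false] using measurableSet_exitTime_le hc x₀ hD t

theorem measurable_exitTime (hm : ∀ t, Measurable (B t)) (hc : ∀ ω, Continuous (B · ω)) (x₀ : ℝ)
    {D : Set ℝ} (hD : IsOpen D) : Measurable (exitTime (fun t ω ↦ x₀ + B t ω) D) := by
  refine measurable_of_Iic fun t ↦ ?_
  induction t with
  | top => simp
  | coe t => exact pastSigma_le hm _ _ (measurableSet_exitTime_le hc x₀ hD t)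

end Stopped

/-! ### Exponential moments -/

theorem EReal.exp_mul_coe_nnreal (γ : ℝ) (t : ℝ≥0) :
    EReal.exp ((γ : EReal) * ((t : ℝ≥0∞) : EReal)) = ENNReal.ofReal (Real.exp (γ * t)) := by
  rw [EReal.coe_nnreal_eq_coe_real, ← EReal.coe_mul, EReal.exp_coe]

theorem expMoment_zero {Ω : Type*} [MeasurableSpace Ω] (P : Measure Ω) [IsProbabilityMeasure P]
    (T : Ω → ℝ≥0∞) : expMoment P T 0 = 1 := by
  simp [expMoment]

theorem expMoment_mono {Ω : Type*} [MeasurableSpace Ω] (P : Measure Ω) (T : Ω → ℝ≥0∞)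
    {γ γ' : ℝ} (h : γ ≤ γ') : expMoment P T γ ≤ expMoment P T γ' :=
  lintegral_mono fun _ ↦ EReal.exp_monotone <|
    mul_le_mul_of_nonneg_right (EReal.coe_le_coe_iff.2 h) (EReal.coe_ennreal_nonneg _)

/-! ### Exit from an interval -/

section Interval

variable {Ω : Type*} {B : ℝ≥0 → Ω → ℝ} {a b x₀ : ℝ}

theorem abs_add_le_of_le_exitTime {ω : Ω} (hc : Continuous (B · ω)) (h0 : B 0 ω = 0)
    (hx₀ : x₀ ∈ Set.Ioo a b) {t : ℝ≥0}
    (ht : t ≤ exitTime (fun t ω ↦ x₀ + B t ω) (Set.Ioo a b) ω) :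
    |B t ω + (x₀ - (a + b) / 2)| ≤ (b - a) / 2 := by
  have hmem := mem_closure_of_le_exitTime (X := fun t ω ↦ x₀ + B t ω) (by fun_prop)
    (by simpa [h0] using hx₀) ht
  rw [closure_Ioo (hx₀.1.trans hx₀.2).ne, Set.mem_Icc] at hmem
  rw [abs_le]
  constructor <;> linarith [hmem.1, hmem.2]

theorem abs_add_eq_of_exitTime_eq {ω : Ω} (hc : Continuous (B · ω)) (h0 : B 0 ω = 0)
    (hx₀ : x₀ ∈ Set.Ioo a b) {t : ℝ≥0}
    (ht : exitTime (fun t ω ↦ x₀ + B t ω) (Set.Ioo a b) ω = t) :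
    |B t ω + (x₀ - (a + b) / 2)| = (b - a) / 2 := by
  refine (abs_add_le_of_le_exitTime hc h0 hx₀ ht.ge).antisymm (not_lt.1 fun hlt ↦ ?_)
  refine notMem_of_exitTime_eq (X := fun t ω ↦ x₀ + B t ω) isOpen_Ioo (by fun_prop) ht ?_
  rw [abs_lt] at hlt
  constructor <;> linarith [hlt.1, hlt.2]

theorem cos_le_cos_of_le_exitTime {ω : Ω} (hc : Continuous (B · ω)) (h0 : B 0 ω = 0)
    (hx₀ : x₀ ∈ Set.Ioo a b) {θ : ℝ} (hθ : 0 ≤ θ) (hθ' : θ * ((b - a) / 2) ≤ Real.pi) {t : ℝ≥0}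
    (ht : t ≤ exitTime (fun t ω ↦ x₀ + B t ω) (Set.Ioo a b) ω) :
    Real.cos (θ * ((b - a) / 2)) ≤ Real.cos (θ * (B t ω + (x₀ - (a + b) / 2))) := by
  rw [← Real.cos_abs (θ * (B t ω + _)), abs_mul, abs_of_nonneg hθ]
  exact Real.cos_le_cos_of_nonneg_of_le_pi (by positivity) hθ'
    (mul_le_mul_of_nonneg_left (abs_add_le_of_le_exitTime hc h0 hx₀ ht) hθ)

/-- If `τ` is finite, the sequence is eventually constant. If `τ = ∞`, the lower bound on the cosine
drives it to `∞`, so almost sure finiteness of `τ` need not be known in advance. -/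
theorem tendsto_expCos_min_exitTime {ω : Ω} (hc : Continuous (B · ω)) (h0 : B 0 ω = 0)
    (hx₀ : x₀ ∈ Set.Ioo a b) {θ : ℝ} (hθ : 0 < θ) (hθ' : θ * ((b - a) / 2) < Real.pi / 2) :
    Filter.Tendsto (fun m : ℕ ↦ ENNReal.ofReal (expCos B θ (x₀ - (a + b) / 2)
        (min (exitTime (fun t ω ↦ x₀ + B t ω) (Set.Ioo a b) ω) (m : ℝ≥0)).toNNReal ω)) .atTop
      (nhds (EReal.exp (((θ ^ 2 / 2 : ℝ) : EReal) *
          (exitTime (fun t ω ↦ x₀ + B t ω) (Set.Ioo a b) ω : EReal)) *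
        ENNReal.ofReal (Real.cos (θ * ((b - a) / 2))))) := by
  have hab : a < b := hx₀.1.trans hx₀.2
  have hκ : 0 < Real.cos (θ * ((b - a) / 2)) := by
    have : 0 ≤ θ * ((b - a) / 2) := mul_nonneg hθ.le (by linarith)
    exact Real.cos_pos_of_mem_Ioo ⟨by linarith [Real.pi_pos], hθ'⟩
  cases hτ : exitTime (fun t ω ↦ x₀ + B t ω) (Set.Ioo a b) ω with
  | top =>
    have hγ : 0 < θ ^ 2 / 2 := by positivity
    rw [EReal.coe_ennreal_top, EReal.coe_mul_top_of_pos hγ, EReal.exp_top,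
      ENNReal.top_mul (by simpa using hκ)]
    refine ENNReal.tendsto_ofReal_nhds_top.2 ?_
    refine Filter.tendsto_atTop_mono (f := fun m : ℕ ↦
      Real.exp (θ ^ 2 / 2 * m) * Real.cos (θ * ((b - a) / 2))) (fun m ↦ ?_) ?_
    · simp only [le_top, inf_of_le_right, ENNReal.toNNReal_coe, expCos, NNReal.coe_natCast]
      gcongr
      exact cos_le_cos_of_le_exitTime hc h0 hx₀ hθ.le (by linarith [Real.pi_pos]) (by simp [hτ])
    · exact (Real.tendsto_exp_atTop.comp
        (tendsto_natCast_atTop_atTop.const_mul_atTop hγ)).atTop_mul_const hκ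
  | coe t =>
    refine tendsto_const_nhds.congr' ?_
    filter_upwards [Filter.eventually_ge_atTop ⌈t⌉₊] with m hm
    have htm : t ≤ (m : ℝ≥0) := Nat.ceil_le.1 hm
    rw [min_eq_left (ENNReal.coe_le_coe.2 htm), ENNReal.toNNReal_coe, expCos,
      EReal.exp_mul_coe_nnreal, ← ENNReal.ofReal_mul (Real.exp_nonneg _),
      ← Real.cos_abs (θ * (B t ω + _)), abs_mul, abs_of_pos hθ,
      abs_add_eq_of_exitTime_eq hc h0 hx₀ hτ]

variable [MeasurableSpace Ω] {P : Measure Ω}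

theorem expMoment_exitTime_eq [IsProbabilityMeasure P] (hB : IsPreBrownianReal B P)
    (hm : ∀ t, Measurable (B t)) (hc : ∀ ω, Continuous (B · ω)) (h0 : ∀ ω, B 0 ω = 0)
    (hx₀ : x₀ ∈ Set.Ioo a b) {θ : ℝ} (hθ : 0 < θ) (hθ' : θ * ((b - a) / 2) < Real.pi / 2) :
    expMoment P (exitTime (fun t ω ↦ x₀ + B t ω) (Set.Ioo a b)) (θ ^ 2 / 2) =
      ENNReal.ofReal (Real.cos (θ * (x₀ - (a + b) / 2)) / Real.cos (θ * ((b - a) / 2))) := by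
  set τ := exitTime (fun t ω ↦ x₀ + B t ω) (Set.Ioo a b) with hτ
  set c := x₀ - (a + b) / 2
  set κ := Real.cos (θ * ((b - a) / 2)) with hκdef
  have hab : a < b := hx₀.1.trans hx₀.2
  have hκ : 0 < κ := by
    have : 0 ≤ θ * ((b - a) / 2) := mul_nonneg hθ.le (by linarith)
    exact Real.cos_pos_of_mem_Ioo ⟨by linarith [Real.pi_pos], hθ'⟩
  let ρ : ℕ → Ω → ℝ≥0 := fun m ω ↦ (min (τ ω) (m : ℝ≥0)).toNNReal
  let Y : ℕ → Ω → ℝ≥0∞ := fun m ω ↦ ENNReal.ofReal (expCos B θ c (ρ m ω) ω)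
  let F : Ω → ℝ≥0∞ := fun ω ↦ EReal.exp (((θ ^ 2 / 2 : ℝ) : EReal) * (τ ω : EReal))
  have hρm (m ω) : ρ m ω ≤ (m : ℝ≥0) := by
    rw [← ENNReal.coe_le_coe, ENNReal.coe_toNNReal (by simp)]
    exact min_le_right _ _
  have hρτ (m ω) : ρ m ω ≤ τ ω := by
    rw [ENNReal.coe_toNNReal (by simp)]
    exact min_le_left _ _
  have hE (m : ℕ) := integral_expCos_min_exitTime hB hm hc h0 x₀
    (isOpen_Ioo (a := a) (b := b)) θ c (m : ℝ≥0)
  have hYm (m) : Measurable (Y m) := (hE m).1.ennreal_ofReal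
  have hnonneg (m ω) : 0 ≤ expCos B θ c (ρ m ω) ω :=
    mul_nonneg (Real.exp_nonneg _) (hκ.le.trans
      (cos_le_cos_of_le_exitTime (hc ω) (h0 ω) hx₀ hθ.le (by linarith [Real.pi_pos]) (hρτ m ω)))
  have hYint (m) : ∫⁻ ω, Y m ω ∂P = ENNReal.ofReal (Real.cos (θ * c)) := by
    rw [← (hE m).2, ofReal_integral_eq_lintegral_ofReal _ (.of_forall (hnonneg m))]
    exact Integrable.of_bound (hE m).1.aestronglyMeasurable _
      (.of_forall fun ω ↦ abs_expCos_le θ c (hρm m ω) ω)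
  have hlim (ω) : Filter.Tendsto (Y · ω) .atTop (nhds (F ω * ENNReal.ofReal κ)) :=
    tendsto_expCos_min_exitTime (hc ω) (h0 ω) hx₀ hθ hθ'
  have hYF (m ω) : Y m ω ≤ F ω := by
    calc Y m ω ≤ ENNReal.ofReal (Real.exp (θ ^ 2 / 2 * ρ m ω)) :=
          ENNReal.ofReal_le_ofReal ((le_abs_self _).trans (abs_expCos_le θ c le_rfl ω))
      _ = EReal.exp (((θ ^ 2 / 2 : ℝ) : EReal) * ((ρ m ω : ℝ≥0∞) : EReal)) :=
          (EReal.exp_mul_coe_nnreal _ _).symm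
      _ ≤ F ω := by
        refine EReal.exp_monotone (mul_le_mul_of_nonneg_left ?_ ?_)
        · exact EReal.coe_ennreal_le_coe_ennreal_iff.2 (hρτ m ω)
        · exact EReal.coe_nonneg.2 (by positivity)
  have hκ0 : ENNReal.ofReal κ ≠ 0 := by simpa using hκ
  have hfatou : (∫⁻ ω, F ω ∂P) * ENNReal.ofReal κ ≤ ENNReal.ofReal (Real.cos (θ * c)) := by
    rw [← lintegral_mul_const' _ _ ENNReal.ofReal_ne_top]
    calc ∫⁻ ω, F ω * ENNReal.ofReal κ ∂P = ∫⁻ ω, Filter.liminf (Y · ω) .atTop ∂P :=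
          lintegral_congr fun ω ↦ (hlim ω).liminf_eq.symm
      _ ≤ Filter.liminf (fun m ↦ ∫⁻ ω, Y m ω ∂P) .atTop := lintegral_liminf_le hYm
      _ = _ := by simp [hYint]
  -- Finiteness makes `F` an admissible dominating function.
  have hfin : ∫⁻ ω, F ω ∂P ≠ ⊤ := by
    intro htop
    rw [htop, ENNReal.top_mul hκ0, top_le_iff] at hfatou
    exact ENNReal.ofReal_ne_top hfatou
  have hdct := tendsto_lintegral_of_dominated_convergence F hYm
    (fun m ↦ .of_forall (hYF m)) hfin (.of_forall hlim)
  simp only [hYint] at hdct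
  have heq := tendsto_nhds_unique tendsto_const_nhds hdct
  rw [lintegral_mul_const' _ _ ENNReal.ofReal_ne_top] at heq
  rw [ENNReal.ofReal_div_of_pos hκ, heq, ENNReal.mul_div_cancel_right hκ0 ENNReal.ofReal_ne_top]
  rfl

theorem expMoment_exitTime_eq_top [IsProbabilityMeasure P] (hB : IsPreBrownianReal B P)
    (hm : ∀ t, Measurable (B t)) (hc : ∀ ω, Continuous (B · ω)) (h0 : ∀ ω, B 0 ω = 0)
    (hx₀ : x₀ ∈ Set.Ioo a b) {γ : ℝ} (hγ : Real.pi ^ 2 / (2 * (b - a) ^ 2) ≤ γ) :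
    expMoment P (exitTime (fun t ω ↦ x₀ + B t ω) (Set.Ioo a b)) γ = ⊤ := by
  have hab : 0 < b - a := sub_pos.2 (hx₀.1.trans hx₀.2)
  -- The critical frequency, at which the denominator `cos (θ (b - a) / 2)` first vanishes.
  set θ₀ := Real.pi / (b - a) with hθ₀
  have hθ₀pos : 0 < θ₀ := div_pos Real.pi_pos hab
  have hθ₀h : θ₀ * ((b - a) / 2) = Real.pi / 2 := by rw [hθ₀]; field_simp
  have hγ₀ : θ₀ ^ 2 / 2 ≤ γ := by
    refine le_of_eq_of_le ?_ hγ
    rw [hθ₀]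
    field_simp
  have hmem : ∀ᶠ θ in nhdsWithin θ₀ (Set.Iio θ₀), 0 < θ ∧ θ < θ₀ := by
    filter_upwards [Ioo_mem_nhdsLT hθ₀pos] with θ hθ using hθ
  have hlt {θ : ℝ} (h : θ < θ₀) : θ * ((b - a) / 2) < Real.pi / 2 := by
    rw [← hθ₀h]
    exact mul_lt_mul_of_pos_right h (by positivity)
  have hnum : 0 < Real.cos (θ₀ * (x₀ - (a + b) / 2)) := by
    refine Real.cos_pos_of_mem_Ioo ⟨?_, ?_⟩
    · rw [← hθ₀h, ← mul_neg]
      exact mul_lt_mul_of_pos_left (by linarith [hx₀.1]) hθ₀pos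
    · rw [← hθ₀h]
      exact mul_lt_mul_of_pos_left (by linarith [hx₀.2]) hθ₀pos
  have hden : Filter.Tendsto (fun θ ↦ Real.cos (θ * ((b - a) / 2)))
      (nhdsWithin θ₀ (Set.Iio θ₀)) (nhdsWithin 0 (Set.Ioi 0)) := by
    refine tendsto_nhdsWithin_iff.2 ⟨?_, ?_⟩
    · have : Continuous fun θ ↦ Real.cos (θ * ((b - a) / 2)) := by fun_prop
      have h := this.tendsto θ₀
      rw [hθ₀h, Real.cos_pi_div_two] at h
      exact h.mono_left nhdsWithin_le_nhds
    · filter_upwards [hmem] with θ hθ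
      have : 0 < θ * ((b - a) / 2) := mul_pos hθ.1 (by positivity)
      exact Real.cos_pos_of_mem_Ioo ⟨by linarith [Real.pi_pos], hlt hθ.2⟩
  have hquot : Filter.Tendsto (fun θ ↦ ENNReal.ofReal
      (Real.cos (θ * (x₀ - (a + b) / 2)) / Real.cos (θ * ((b - a) / 2))))
      (nhdsWithin θ₀ (Set.Iio θ₀)) (nhds ⊤) := by
    refine ENNReal.tendsto_ofReal_nhds_top.2 ?_
    have hcont : Continuous fun θ ↦ Real.cos (θ * (x₀ - (a + b) / 2)) := by fun_prop
    exact ((hcont.tendsto θ₀).mono_left nhdsWithin_le_nhds).pos_mul_atTop hnum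
      (tendsto_inv_nhdsGT_zero.comp hden)
  refine top_le_iff.1 (le_of_tendsto hquot ?_)
  filter_upwards [hmem] with θ hθ
  rw [← expMoment_exitTime_eq hB hm hc h0 hx₀ hθ.1 (hlt hθ.2)]
  refine expMoment_mono _ _ (le_trans ?_ hγ₀)
  have := hθ.1
  have := hθ.2
  gcongr

end Interval

/-! ### The main theorem -/

theorem propositionC1 {Ω : Type*} [MeasurableSpace Ω] (P : Measure Ω) (W : ℝ≥0 → Ω → ℝ)
    (hW : IsBrownianReal W P) (a b x₀ : ℝ) (hx₀ : x₀ ∈ Set.Ioo a b) (τ : Ω → ℝ≥0∞)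
    (hτ : τ = exitTime (fun t ω ↦ x₀ + W t ω) (Set.Ioo a b)) (γ : ℝ) (hγ : 0 ≤ γ) :
    AEMeasurable τ P ∧
    (γ < Real.pi ^ 2 / (2 * (b - a) ^ 2) →
      exitMGF a b x₀ γ = ((Real.cos ((b + a - 2 * x₀) * √(γ / 2)) /
        Real.cos ((b - a) * √(γ / 2)) : ℝ) : ℂ) ∧
      expMoment P τ γ = ENNReal.ofReal (Real.cos ((b + a - 2 * x₀) * √(γ / 2)) /
        Real.cos ((b - a) * √(γ / 2)))) ∧
    (Real.pi ^ 2 / (2 * (b - a) ^ 2) ≤ γ → expMoment P τ γ = ⊤) := by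
  have : IsProbabilityMeasure P := hW.isGaussianProcess.isProbabilityMeasure
  obtain ⟨B, hB, hm, hc, h0, hWB⟩ := hW.exists_continuous_modification
  have hae : τ =ᵐ[P] exitTime (fun t ω ↦ x₀ + B t ω) (Set.Ioo a b) := by
    filter_upwards [hWB] with ω hω
    rw [hτ]
    exact exitTime_congr _ (funext fun t ↦ by rw [hω t])
  have hmom : expMoment P τ γ = expMoment P (exitTime (fun t ω ↦ x₀ + B t ω) (Set.Ioo a b)) γ :=
    lintegral_congr_ae (hae.mono fun ω h ↦ by simp only [h])
  refine ⟨⟨_, measurable_exitTime hm hc x₀ isOpen_Ioo, hae⟩,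
    fun hlt ↦ ⟨exitMGF_ofReal a b x₀ hγ, ?_⟩,
    fun hle ↦ hmom.trans (expMoment_exitTime_eq_top hB hm hc h0 hx₀ hle)⟩
  -- The martingale argument needs `θ > 0`; at `γ = 0` both sides are `1`.
  rcases hγ.eq_or_lt with rfl | hpos
  · simp [expMoment_zero]
  have hab : 0 < b - a := sub_pos.2 (hx₀.1.trans hx₀.2)
  have hy : 0 < √(γ / 2) := Real.sqrt_pos.2 (by positivity)
  have hy2 : √(γ / 2) ^ 2 = γ / 2 := Real.sq_sqrt (by positivity)
  have hsmall : 2 * √(γ / 2) * ((b - a) / 2) < Real.pi / 2 := by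
    refine lt_of_pow_lt_pow_left₀ 2 (by positivity) ?_
    rw [lt_div_iff₀ (by positivity)] at hlt
    calc _ = √(γ / 2) ^ 2 * (b - a) ^ 2 := by ring
      _ < _ := by rw [hy2]; linarith
  have key := expMoment_exitTime_eq hB hm hc h0 hx₀ (θ := 2 * √(γ / 2)) (by positivity) hsmall
  rw [hmom]
  convert key using 3
  · rw [mul_pow, hy2]
    ring
  · rw [← Real.cos_neg]
    congr 1
    ring
  · congr 1
    ring
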